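/- Let $\mathsf H_m=\sum_{j=1}^m\frac1j$ (so $\mathsf H_0=0$) and let $$L=L\left(2,\left(\tfrac{-8}{\cdot}\right)\right)=\sum_{n=1}^\infty\left(\frac{-8}{n}\right)\frac1{n^2},$$ where $\left(\frac{-8}{\cdot}\right)$ is the Kronecker symbol. Then the following five series converge absolutely and have the indicated sums: \begin{align*} \sum_{k=0}^\infty\frac{(350k-17)\binom{2k}k8^k}{\binom{3k}k\binom{6k}{3k}}&=15\sqrt2\,\pi+27,\\ \sum_{k=1}^\infty\frac{\left[21(350k-17)(2\mathsf H_{6k-1}-\mathsf H_{3k-1}-\mathsf H_{k-1})+4850\right]\binom{2k}k8^k}{\binom{3k}k\binom{6k}{3k}}&=976+1020\sqrt2\,\pi+945\sqrt2\,\pi\log2,\\ \sum_{k=1}^\infty\frac{\left[7(350k-17)(\mathsf H_{2k-1}-\mathsf H_{k-1})+2225\right]\binom{2k}k8^k}{\binom{3k}k\binom{6k}{3k}}&=276+\frac{493\pi}{\sqrt2}+\frac{315\pi\log2}{\sqrt2}-420L,\\ \sum_{k=1}^\infty\frac{\left[(50k-7)(\mathsf H_{2k-1}-\mathsf H_{k-1})+5\right]\binom{2k}k8^k}{k\binom{3k}k\binom{6k}{3k}}&=3\sqrt2\,\pi(1+\log2)-8L,\\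 \sum_{k=1}^\infty\frac{\left[(50k-7)(2\mathsf H_{6k-1}-\mathsf H_{3k-1}-\mathsf H_{k-1})-10\right]\binom{2k}k8^k}{k\binom{3k}k\binom{6k}{3k}}&=2\sqrt2\,\pi(2+3\log2). \end{align*} -/

import Mathlib

/-- The Kronecker symbol `(a / n)` for an integer `a` and a positive integer `n`: if `n = 2 ^ e * m`
with `m` odd, it is `(a / 2) ^ e * (a / m)`, where `(a / m)` is the Jacobi symbol and `(a / 2)` is
`0` for even `a`, `1` for `a ≡ ±1 (mod 8)` and `-1` for `a ≡ ±3 (mod 8)`. -/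
def kroneckerSymbol (a : ℤ) (n : ℕ+) : ℤ :=
  ZMod.χ₈ (a : ZMod 8) ^ (n : ℕ).factorization 2 *
    jacobiSym a ((n : ℕ) / 2 ^ (n : ℕ).factorization 2)

/-- The Kronecker symbol `(-8 / ·)` is the odd primitive quadratic Dirichlet character modulo 8. -/
theorem kroneckerSymbol_neg_eight (n : ℕ+) :
    kroneckerSymbol (-8) n = ZMod.χ₈' ((n : ℕ) : ZMod 8) := by
  unfold kroneckerSymbol
  rcases Nat.even_or_odd (n : ℕ) with hn | hn
  · have h2 : 2 ∣ (n : ℕ) := hn.two_dvd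
    have he : (n : ℕ).factorization 2 ≠ 0 :=
      (Nat.prime_two.factorization_pos_of_dvd n.ne_zero h2).ne'
    have h0 : ZMod.χ₈ ((-8 : ℤ) : ZMod 8) = 0 := by decide
    rw [h0, zero_pow he, zero_mul, ZMod.χ₈'_nat_eq_if_mod_eight,
      if_pos (Nat.even_iff.mp hn)]
  · have h2 : ¬ 2 ∣ (n : ℕ) := hn.not_two_dvd_nat
    rw [Nat.factorization_eq_zero_of_not_dvd h2, pow_zero, one_mul, pow_zero, Nat.div_one,
      show (-8 : ℤ) = -2 * 4 by norm_num, jacobiSym.mul_left, jacobiSym.at_four hn, mul_one,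
      jacobiSym.at_neg_two hn]

/-- The series defining `L(2, (-8 / ·))` converges absolutely. -/
theorem summable_kroneckerSymbol_neg_eight :
    Summable fun n : ℕ+ => (kroneckerSymbol (-8) n : ℝ) / ((n : ℕ) : ℝ) ^ 2 := by
  have h : Summable fun n : ℕ+ => 1 / ((n : ℕ) : ℝ) ^ 2 :=
    (Real.summable_one_div_nat_pow.mpr one_lt_two).comp_injective PNat.coe_injective
  refine Summable.of_norm_bounded h fun n => ?_
  rw [norm_div, norm_pow, Real.norm_natCast]
  gcongr
  rw [kroneckerSymbol_neg_eight, ZMod.χ₈'_nat_eq_if_mod_eight]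
  split_ifs <;> simp

/-- The value `L(2, (-8 / ·)) = ∑_{n ≥ 1} (-8 / n) / n ^ 2` of the Dirichlet `L`-function. -/
noncomputable def LTwoNegEight : ℝ :=
  ∑' n : ℕ+, (kroneckerSymbol (-8) n : ℝ) / ((n : ℕ) : ℝ) ^ 2

/-- The harmonic number `H_m = ∑_{j = 1}^m 1 / j`, as a real number. -/
noncomputable def Hnum (m : ℕ) : ℝ := (harmonic m : ℝ)

/-- The weight `C(2k, k) 8 ^ k / (C(3k, k) C(6k, 3k))`. -/
noncomputable def binomWeight (k : ℕ) : ℝ :=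
  ((2 * k).choose k * 8 ^ k : ℝ) / ((3 * k).choose k * (6 * k).choose (3 * k))

/-! Writing `K = k + 1`, the quotient `binomWeight K / K` is a beta integral of `y ^ (2K) (1 - y²) ^
(2K - 1)` over `[0, 1]`, up to a power of 2. Inserting `log y` and `log (1 - y²)` produces harmonic
numbers, and the combination `logFactor c` is tuned so that `c = 1` and `c = 2` give exactly the two
harmonic expressions of the theorem (`integral_weightKernel_mul_logFactor_one`,
`integral_weightKernel_mul_logFactor_two`).

In `k` the integrand is geometric with ratio `z = y² (1 - y²)² / 2`, and `1 - z = (2 - y²)(1 + y⁴) /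
2` factors. Summing under the integral sign (`hasSum_integral_weightKernel`) turns every series into
`∫ (R · logFactor c + C)` with `R`, `C` rational.

The coefficients `50K - 7` and `K(350K - 17)` are such that `R` is the derivative of a rational
function plus a multiple of `w = (1 + y²) / (1 + y⁴)`. Integration by parts
(`integral_mul_logFactor_add`) then leaves `∫ w · logFactor c` and a rational integral; the latter
reduces to boundary values, `∫ w` and the vanishing integral of `nullWeight`.

Finally `∫ w = π / (2√2)`, `∫ w log y = -L` by expanding `w` modulo 8, and `∫ w log (1 - y²)`
reduces to these by the substitution `v = (1 - y²) / (√2 y)`. In `∫ w · logFactor c` the value `L`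
has coefficient `-(2 - c)`, which is why it is absent for `c = 2`. -/

open MeasureTheory intervalIntegral Set

/-! ### Odd harmonic sums and beta values at half-integers. -/

/-- The sum of the reciprocals of the first `n` odd numbers. -/
noncomputable def oddHarmonic (n : ℕ) : ℝ := ∑ j ∈ Finset.range n, 1 / (2 * (j : ℝ) + 1)

theorem oddHarmonic_succ (n : ℕ) :
    oddHarmonic (n + 1) = oddHarmonic n + 1 / (2 * (n : ℝ) + 1) := by
  simp [oddHarmonic, Finset.sum_range_succ]

theorem Hnum_succ (n : ℕ) : Hnum (n + 1) = Hnum n + 1 / ((n : ℝ) + 1) := by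
  simp [Hnum, harmonic_succ]

theorem Hnum_zero : Hnum 0 = 0 := by simp [Hnum]

theorem two_mul_oddHarmonic (n : ℕ) : 2 * oddHarmonic n = 2 * Hnum (2 * n) - Hnum n := by
  induction n with
  | zero => simp [oddHarmonic, Hnum]
  | succ n ih =>
    rw [oddHarmonic_succ, show 2 * (n + 1) = 2 * n + 1 + 1 by ring, Hnum_succ, Hnum_succ, Hnum_succ]
    push_cast
    have h : (2 * (n : ℝ) + 1 + 1) = 2 * (n + 1) := by ring
    rw [mul_add, ih, h]
    field_simp
    ring

/-- The value of `∫₀¹ y ^ (2n) (1 - y²) ^ m dy`. -/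
noncomputable def evenBeta (m n : ℕ) : ℝ :=
  (m.factorial * 2 ^ (2 * m + 1) * (n + m + 1).factorial * (2 * n).factorial : ℝ) /
    ((2 * (n + m + 1)).factorial * n.factorial)

theorem evenBeta_zero (n : ℕ) : evenBeta 0 n = 1 / (2 * (n : ℝ) + 1) := by
  simp only [evenBeta, show 2 * (n + 0 + 1) = 2 * n + 1 + 1 by ring, add_zero,
    Nat.factorial_succ, Nat.factorial_zero]
  have := Nat.factorial_ne_zero (2 * n)
  have := Nat.factorial_ne_zero n
  push_cast
  field_simp
  ring

theorem factorial_two_mul_succ (n : ℕ) :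
    (2 * (n + 1)).factorial = (2 * n + 2) * ((2 * n + 1) * (2 * n).factorial) := by
  rw [show 2 * (n + 1) = 2 * n + 1 + 1 by ring, Nat.factorial_succ, Nat.factorial_succ]

theorem evenBeta_right (m n : ℕ) :
    evenBeta m (n + 1) = evenBeta m n * ((2 * n + 1) / (2 * (n + m) + 3)) := by
  unfold evenBeta
  rw [show n + 1 + m + 1 = (n + m + 1) + 1 by ring, factorial_two_mul_succ (n + m + 1),
    factorial_two_mul_succ n, Nat.factorial_succ (n + m + 1), Nat.factorial_succ n]
  push_cast
  rw [show 2 * ((n : ℝ) + m + 1) + 1 = 2 * (n + m) + 3 by ring]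
  field_simp

theorem evenBeta_left (m n : ℕ) :
    evenBeta (m + 1) n = evenBeta m n * (2 * (m + 1) / (2 * (n + m) + 3)) := by
  unfold evenBeta
  rw [show n + (m + 1) + 1 = (n + m + 1) + 1 by ring, factorial_two_mul_succ (n + m + 1),
    Nat.factorial_succ (n + m + 1), Nat.factorial_succ m]
  push_cast
  rw [show 2 * ((n : ℝ) + m + 1) + 1 = 2 * (n + m) + 3 by ring,
    show 2 * (m + 1) + 1 = 2 * m + 1 + 1 + 1 by ring, pow_succ, pow_succ]
  field_simp

/-! ### Moments of 1, log y and log (1 - y²). -/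

theorem log_one_sub_sq {y : ℝ} (hy : y ∈ Ioo (0 : ℝ) 1) :
    Real.log (1 - y ^ 2) = Real.log (1 - y) + Real.log (1 + y) := by
  rw [← Real.log_mul (by linarith [hy.2]) (by linarith [hy.1])]
  congr 1; ring

theorem intervalIntegrable_log_one_sub_sq :
    IntervalIntegrable (fun y : ℝ => Real.log (1 - y ^ 2)) volume 0 1 := by
  have h1 : IntervalIntegrable (fun y : ℝ => Real.log (1 - y)) volume 0 1 := by
    have := (intervalIntegrable_log' (a := 1) (b := 0)).comp_sub_left 1
    simpa using this
  have h2 : IntervalIntegrable (fun y : ℝ => Real.log (1 + y)) volume 0 1 := by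
    have := (intervalIntegrable_log' (a := 1) (b := 2)).comp_add_left 1
    norm_num at this
    simpa using this
  refine (h1.add h2).congr_uIoo fun y hy => ?_
  rw [uIoo_of_le zero_le_one] at hy
  simp [log_one_sub_sq hy]

theorem integral_pow_mul_log (n : ℕ) :
    ∫ y in (0 : ℝ)..1, y ^ n * Real.log y = -1 / ((n : ℝ) + 1) ^ 2 := by
  have hn : (n : ℝ) + 1 ≠ 0 := by positivity
  -- The primitive is grouped around `y * log y`, which is continuous at 0; the same device with `t
  -- * log t` handles the endpoint 1 in the integrals of `log (1 - y²)`.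
  have hc : Continuous fun y : ℝ => y ^ n * (y * Real.log y) / (n + 1) - y ^ (n + 1) / (n + 1) ^ 2 :=
    (((continuous_id.pow n).mul Real.continuous_mul_log).div_const _).sub (by fun_prop)
  rw [integral_eq_sub_of_hasDerivAt_of_le zero_le_one hc.continuousOn (f' := fun y => y ^ n * Real.log y)]
  · simp; ring
  · intro y hy
    have hy0 : y ≠ 0 := hy.1.ne'
    have e : (fun y : ℝ => y ^ n * (y * Real.log y) / (n + 1) - y ^ (n + 1) / (n + 1) ^ 2) =
        fun y : ℝ => y ^ (n + 1) * Real.log y / (n + 1) - y ^ (n + 1) / (n + 1) ^ 2 := by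
      ext y; ring
    rw [e]
    have h := (((hasDerivAt_pow (n + 1) y).mul (Real.hasDerivAt_log hy0)).div_const ((n : ℝ) + 1)).sub
      ((hasDerivAt_pow (n + 1) y).div_const (((n : ℝ) + 1) ^ 2))
    refine h.congr_deriv ?_
    push_cast
    field_simp
    ring
  · exact intervalIntegrable_log'.continuousOn_mul (by fun_prop)

theorem integral_log_one_sub_sq :
    ∫ y in (0 : ℝ)..1, Real.log (1 - y ^ 2) = 2 * Real.log 2 - 2 := by
  have hc : Continuous fun y : ℝ => (1 + y) * Real.log (1 + y) - (1 - y) * Real.log (1 - y) - 2 * y :=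
    ((Real.continuous_mul_log.comp (by fun_prop : Continuous fun y : ℝ => 1 + y)).sub
      (Real.continuous_mul_log.comp (by fun_prop : Continuous fun y : ℝ => 1 - y))).sub (by fun_prop)
  rw [integral_eq_sub_of_hasDerivAt_of_le zero_le_one hc.continuousOn _
    intervalIntegrable_log_one_sub_sq]
  · norm_num
  · intro y hy
    have h1 : (1 + y) ≠ 0 := by linarith [hy.1]
    have h2 : (1 - y) ≠ 0 := by linarith [hy.2]
    have d1 := (hasDerivAt_id' y).const_add 1
    have d2 := (hasDerivAt_id' y).const_sub 1
    have h := ((d1.mul (d1.log h1)).sub (d2.mul (d2.log h2))).sub ((hasDerivAt_id' y).const_mul 2)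
    refine h.congr_deriv ?_
    rw [log_one_sub_sq hy]
    field_simp
    ring

/-- The function `y ^ (2n+1) (1 - y²) log (1 - y²)` vanishes at both endpoints, so integrating its
derivative gives a recurrence between the moments `n` and `n + 1`. -/
theorem integral_pow_mul_log_one_sub_sq (n : ℕ) :
    ∫ y in (0 : ℝ)..1, y ^ (2 * n) * Real.log (1 - y ^ 2) =
      (2 * Real.log 2 - 2 * oddHarmonic (n + 1)) / (2 * n + 1) := by
  induction n with
  | zero => simp [integral_log_one_sub_sq, oddHarmonic]
  | succ n ih =>
    have hI (k : ℕ) : IntervalIntegrable (fun y : ℝ => y ^ k * Real.log (1 - y ^ 2)) volume 0 1 :=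
      intervalIntegrable_log_one_sub_sq.continuousOn_mul (by fun_prop)
    have hc : Continuous fun y : ℝ => -(y ^ (2 * n + 1) * ((1 - y ^ 2) * Real.log (1 - y ^ 2))) :=
      ((continuous_id.pow _).mul
        (Real.continuous_mul_log.comp (by fun_prop : Continuous fun y : ℝ => 1 - y ^ 2))).neg
    have hF := integral_eq_sub_of_hasDerivAt_of_le zero_le_one hc.continuousOn
      (f' := fun y => (2 * n + 3) * (y ^ (2 * (n + 1)) * Real.log (1 - y ^ 2)) -
        (2 * n + 1) * (y ^ (2 * n) * Real.log (1 - y ^ 2)) + 2 * y ^ (2 * n + 2)) (by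
        intro y hy
        have h1 : 1 - y ^ 2 ≠ 0 := by nlinarith [hy.1, hy.2]
        have d := (hasDerivAt_pow 2 y).const_sub 1
        have h := ((hasDerivAt_pow (2 * n + 1) y).mul (d.mul (d.log h1))).neg
        refine h.congr_deriv ?_
        push_cast
        simp only [Pi.mul_apply]
        field_simp
        ring) (by
        exact (((hI _).const_mul _).sub ((hI _).const_mul _)).add
          (by apply Continuous.intervalIntegrable; fun_prop))
    rw [integral_add (((hI _).const_mul _).sub ((hI _).const_mul _))
      (by apply Continuous.intervalIntegrable; fun_prop),
      integral_sub ((hI _).const_mul _) ((hI _).const_mul _), intervalIntegral.integral_const_mul,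
      intervalIntegral.integral_const_mul, ih, intervalIntegral.integral_const_mul, integral_pow] at hF
    rw [oddHarmonic_succ (n + 1)]
    push_cast at hF ⊢
    norm_num at hF
    have a1 : (2 * (n : ℝ) + 1) ≠ 0 := by positivity
    have a2 : (2 * (n : ℝ) + 3) ≠ 0 := by positivity
    have a3 : (2 * (n : ℝ) + 2 + 1) ≠ 0 := by positivity
    have e1 : 2 * ((n : ℝ) + 1) + 1 = 2 * n + 3 := by ring
    have e3 : 2 * (n : ℝ) + 2 + 1 = 2 * n + 3 := by ring
    rw [e1]
    rw [e3] at hF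
    rw [eq_div_iff a2]
    field_simp at hF ⊢
    linarith

/-- Splitting off one factor `1 - y²` lowers `m` at the cost of raising `n`. All three moment
formulas below follow by induction on `m` with `n` free, starting from the pure power moments. -/
theorem integral_moment_succ {g : ℝ → ℝ} (hg : IntervalIntegrable g volume 0 1) (m n : ℕ) :
    ∫ y in (0 : ℝ)..1, y ^ (2 * n) * (1 - y ^ 2) ^ (m + 1) * g y =
      (∫ y in (0 : ℝ)..1, y ^ (2 * n) * (1 - y ^ 2) ^ m * g y) -
        ∫ y in (0 : ℝ)..1, y ^ (2 * (n + 1)) * (1 - y ^ 2) ^ m * g y := by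
  rw [← integral_sub (hg.continuousOn_mul (by fun_prop)) (hg.continuousOn_mul (by fun_prop))]
  congr 1; ext y; ring

theorem integral_moment (m n : ℕ) :
    ∫ y in (0 : ℝ)..1, y ^ (2 * n) * (1 - y ^ 2) ^ m * 1 = evenBeta m n := by
  induction m generalizing n with
  | zero => simp [evenBeta_zero]
  | succ m ih =>
    rw [integral_moment_succ intervalIntegrable_const, ih, ih, evenBeta_right, evenBeta_left]
    field_simp
    ring

theorem integral_moment_log (m n : ℕ) :
    ∫ y in (0 : ℝ)..1, y ^ (2 * n) * (1 - y ^ 2) ^ m * Real.log y =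
      evenBeta m n * (oddHarmonic n - oddHarmonic (n + m + 1)) := by
  induction m generalizing n with
  | zero =>
    simp only [pow_zero, mul_one, integral_pow_mul_log, evenBeta_zero, add_zero, oddHarmonic_succ]
    push_cast
    field_simp
    ring
  | succ m ih =>
    rw [integral_moment_succ intervalIntegrable_log', ih, ih, evenBeta_right, evenBeta_left,
      show n + 1 + m + 1 = n + m + 1 + 1 by ring, show n + (m + 1) + 1 = n + m + 1 + 1 by ring,
      oddHarmonic_succ (n + m + 1), oddHarmonic_succ n]
    push_cast
    have e : 2 * ((n : ℝ) + m + 1) + 1 = 2 * (n + m) + 3 := by ring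
    rw [e]
    field_simp
    ring

theorem integral_moment_log_one_sub_sq (m n : ℕ) :
    ∫ y in (0 : ℝ)..1, y ^ (2 * n) * (1 - y ^ 2) ^ m * Real.log (1 - y ^ 2) =
      evenBeta m n * (Hnum m + 2 * Real.log 2 - 2 * oddHarmonic (n + m + 1)) := by
  induction m generalizing n with
  | zero =>
    simp only [pow_zero, mul_one, integral_pow_mul_log_one_sub_sq, evenBeta_zero, add_zero,
      Hnum_zero]
    ring
  | succ m ih =>
    rw [integral_moment_succ intervalIntegrable_log_one_sub_sq, ih, ih, evenBeta_right,
      evenBeta_left, show n + 1 + m + 1 = n + m + 1 + 1 by ring,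
      show n + (m + 1) + 1 = n + m + 1 + 1 by ring, oddHarmonic_succ (n + m + 1), Hnum_succ]
    push_cast
    have e : 2 * ((n : ℝ) + m + 1) + 1 = 2 * (n + m) + 3 := by ring
    rw [e]
    field_simp
    ring

/-! ### Integral representation of the weights and of their harmonic multiples. -/

theorem binomWeight_succ_div (k : ℕ) :
    binomWeight (k + 1) / ((k : ℝ) + 1) =
      4 * (1 / 2) ^ (k + 1) * evenBeta (2 * k + 1) (k + 1) := by
  unfold binomWeight evenBeta
  rw [Nat.cast_choose ℝ (by omega : k + 1 ≤ 2 * (k + 1)),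
    Nat.cast_choose ℝ (by omega : k + 1 ≤ 3 * (k + 1)),
    Nat.cast_choose ℝ (by omega : 3 * (k + 1) ≤ 6 * (k + 1)),
    show 2 * (k + 1) - (k + 1) = k + 1 by omega, show 3 * (k + 1) - (k + 1) = 2 * (k + 1) by omega,
    show 6 * (k + 1) - 3 * (k + 1) = 3 * (k + 1) by omega,
    show k + 1 + (2 * k + 1) + 1 = 3 * (k + 1) by ring,
    show 2 * (3 * (k + 1)) = 6 * (k + 1) by ring]
  have h : ((2 * (k + 1)).factorial : ℝ) = 2 * ((k : ℝ) + 1) * (2 * k + 1).factorial := by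
    rw [show 2 * (k + 1) = 2 * k + 1 + 1 by ring, Nat.factorial_succ]
    push_cast; ring
  have h8 : (8 : ℝ) ^ (k + 1) = 4 * 2 ^ (2 * (2 * k + 1) + 1) * (1 / 2) ^ (k + 1) / 2 := by
    rw [show 2 * (2 * k + 1) + 1 = 4 * k + 3 by ring, pow_add _ (4 * k), pow_mul, pow_succ, pow_succ]
    have : (8 : ℝ) ^ k = (2 ^ 4) ^ k * (1 / 2) ^ k := by rw [← mul_pow]; norm_num
    rw [this]; ring
  rw [h8, h]
  have := Nat.factorial_ne_zero (2 * k + 1)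
  have := Nat.factorial_ne_zero (3 * (k + 1))
  have := Nat.factorial_ne_zero (6 * (k + 1))
  have := Nat.factorial_ne_zero (k + 1)
  field_simp

/-- The integrand whose integral over `[0, 1]` is `binomWeight (k + 1) / (k + 1)`. -/
noncomputable def weightKernel (k : ℕ) (y : ℝ) : ℝ :=
  4 * (1 / 2) ^ (k + 1) * (y ^ (2 * (k + 1)) * (1 - y ^ 2) ^ (2 * k + 1))

theorem continuous_weightKernel (k : ℕ) : Continuous (weightKernel k) := by
  unfold weightKernel; fun_prop

theorem integral_weightKernel (k : ℕ) :
    ∫ y in (0 : ℝ)..1, weightKernel k y = binomWeight (k + 1) / ((k : ℝ) + 1) := by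
  rw [binomWeight_succ_div, ← integral_moment, ← intervalIntegral.integral_const_mul]
  congr 1; ext y; rw [weightKernel]; ring

/-- The logarithmic factor `2c log 2 + 2 log y - c log (1 - y²)`. -/
noncomputable def logFactor (c y : ℝ) : ℝ :=
  2 * c * Real.log 2 + 2 * Real.log y - c * Real.log (1 - y ^ 2)

theorem intervalIntegrable_logFactor (c : ℝ) :
    IntervalIntegrable (logFactor c) volume 0 1 :=
  (intervalIntegrable_const.add (intervalIntegrable_log'.const_mul 2)).sub
    (intervalIntegrable_log_one_sub_sq.const_mul c)

/-- The constant `2c log 2` in `logFactor` is there to cancel the `log 2` in the moment of `log (1 -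
y²)`, leaving only rational harmonic sums. -/
theorem integral_weightKernel_mul_logFactor (c : ℝ) (k : ℕ) :
    ∫ y in (0 : ℝ)..1, weightKernel k y * logFactor c y =
      binomWeight (k + 1) / ((k : ℝ) + 1) *
        (2 * oddHarmonic (k + 1) + (2 * c - 2) * oddHarmonic (3 * (k + 1)) - c * Hnum (2 * k + 1)) := by
  have e : (fun y => weightKernel k y * logFactor c y) = fun y => 4 * (1 / 2) ^ (k + 1) *
      (2 * c * Real.log 2 * (y ^ (2 * (k + 1)) * (1 - y ^ 2) ^ (2 * k + 1) * 1) +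
        2 * (y ^ (2 * (k + 1)) * (1 - y ^ 2) ^ (2 * k + 1) * Real.log y) -
        c * (y ^ (2 * (k + 1)) * (1 - y ^ 2) ^ (2 * k + 1) * Real.log (1 - y ^ 2))) := by
    ext y; rw [weightKernel, logFactor]; ring
  have i1 : IntervalIntegrable (fun y : ℝ => y ^ (2 * (k + 1)) * (1 - y ^ 2) ^ (2 * k + 1) * 1)
      volume 0 1 := intervalIntegrable_const.continuousOn_mul (by fun_prop)
  have i2 : IntervalIntegrable
      (fun y : ℝ => y ^ (2 * (k + 1)) * (1 - y ^ 2) ^ (2 * k + 1) * Real.log y) volume 0 1 :=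
    intervalIntegrable_log'.continuousOn_mul (by fun_prop)
  have i3 : IntervalIntegrable
      (fun y : ℝ => y ^ (2 * (k + 1)) * (1 - y ^ 2) ^ (2 * k + 1) * Real.log (1 - y ^ 2)) volume 0 1 :=
    intervalIntegrable_log_one_sub_sq.continuousOn_mul (by fun_prop)
  rw [e, intervalIntegral.integral_const_mul,
    intervalIntegral.integral_sub ((i1.const_mul _).add (i2.const_mul _)) (i3.const_mul _),
    intervalIntegral.integral_add (i1.const_mul _) (i2.const_mul _),
    intervalIntegral.integral_const_mul, intervalIntegral.integral_const_mul,
    intervalIntegral.integral_const_mul, integral_moment, integral_moment_log,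
    integral_moment_log_one_sub_sq, binomWeight_succ_div,
    show k + 1 + (2 * k + 1) + 1 = 3 * (k + 1) by ring]
  ring

theorem two_mul_oddHarmonic_succ (n : ℕ) :
    2 * oddHarmonic (n + 1) = 2 * Hnum (2 * (n + 1) - 1) - Hnum n := by
  rw [two_mul_oddHarmonic, Hnum_succ n, show 2 * (n + 1) = 2 * n + 1 + 1 by ring, Hnum_succ,
    Nat.add_sub_cancel]
  push_cast
  rw [show 2 * (n : ℝ) + 1 + 1 = 2 * (n + 1) by ring]
  field_simp
  ring

/-- The value `c = 1` removes the odd harmonic sum of length `3(k + 1)`. -/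
theorem integral_weightKernel_mul_logFactor_one (k : ℕ) :
    ∫ y in (0 : ℝ)..1, weightKernel k y * logFactor 1 y =
      binomWeight (k + 1) / ((k : ℝ) + 1) * (Hnum (2 * (k + 1) - 1) - Hnum k) := by
  rw [integral_weightKernel_mul_logFactor, two_mul_oddHarmonic_succ,
    show 2 * (k + 1) - 1 = 2 * k + 1 by omega]
  ring

/-- With `c = 2` the two occurrences of `Hnum (2k + 1)` cancel, and the sum of length `3(k + 1)`
supplies the terms with indices near `6k` and `3k`. -/
theorem integral_weightKernel_mul_logFactor_two (k : ℕ) :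
    ∫ y in (0 : ℝ)..1, weightKernel k y * logFactor 2 y =
      binomWeight (k + 1) / ((k : ℝ) + 1) *
        (2 * Hnum (6 * (k + 1) - 1) - Hnum (3 * (k + 1) - 1) - Hnum k) := by
  have h := two_mul_oddHarmonic_succ (3 * k + 2)
  rw [show 3 * k + 2 + 1 = 3 * (k + 1) by ring, show 2 * (3 * (k + 1)) - 1 = 6 * (k + 1) - 1 by omega,
    show 3 * k + 2 = 3 * (k + 1) - 1 by omega] at h
  rw [integral_weightKernel_mul_logFactor, two_mul_oddHarmonic_succ,
    show (2 * 2 - 2 : ℝ) = 2 by norm_num, h, show 2 * (k + 1) - 1 = 2 * k + 1 by omega]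
  ring

/-! ### The integral of w, and of w against log (1 - y²). -/

/-- The weight `(1 + y²) / (1 + y⁴)`, whose integral over `[0, 1]` is `π / (2√2)`. -/
noncomputable def quarticWeight (y : ℝ) : ℝ := (1 + y ^ 2) / (1 + y ^ 4)

theorem one_add_pow_four_pos (y : ℝ) : 0 < 1 + y ^ 4 := by positivity

theorem continuous_quarticWeight : Continuous quarticWeight :=
  Continuous.div (by fun_prop) (by fun_prop) fun y => (one_add_pow_four_pos y).ne'

theorem integral_quarticWeight :
    ∫ y in (0 : ℝ)..1, quarticWeight y = Real.pi / (2 * √2) := by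
  have s2 : √2 ^ 2 = (2 : ℝ) := Real.sq_sqrt (by norm_num)
  have s0 : √2 ≠ (0 : ℝ) := by positivity
  have key : ∀ y : ℝ, HasDerivAt
      (fun y => (Real.arctan (√2 * y + 1) + Real.arctan (√2 * y - 1)) / √2) (quarticWeight y) y := by
    intro y
    have d := (hasDerivAt_id' y).const_mul √2
    refine (((d.add_const 1).arctan.add (d.sub_const 1).arctan).div_const √2).congr_deriv ?_
    have e1 : 1 + (√2 * y + 1) ^ 2 = 2 * (y ^ 2 + √2 * y + 1) := by linear_combination y ^ 2 * s2
    have e2 : 1 + (√2 * y - 1) ^ 2 = 2 * (y ^ 2 - √2 * y + 1) := by linear_combination y ^ 2 * s2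
    have p1 : y ^ 2 + √2 * y + 1 ≠ 0 := by
      have : 0 < 1 + (√2 * y + 1) ^ 2 := by positivity
      intro h; rw [e1, h] at this; norm_num at this
    have p2 : y ^ 2 - √2 * y + 1 ≠ 0 := by
      have : 0 < 1 + (√2 * y - 1) ^ 2 := by positivity
      intro h; rw [e2, h] at this; norm_num at this
    have e3 : 1 + y ^ 4 = (y ^ 2 + √2 * y + 1) * (y ^ 2 - √2 * y + 1) := by
      linear_combination y ^ 2 * s2
    have e4 : (y ^ 2 + √2 * y + 1) + (y ^ 2 - √2 * y + 1) = 2 * (1 + y ^ 2) := by ring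
    rw [quarticWeight, e1, e2, e3]
    generalize y ^ 2 + √2 * y + 1 = A at p1 e4 ⊢
    generalize y ^ 2 - √2 * y + 1 = B at p2 e4 ⊢
    field_simp
    linear_combination e4
  rw [integral_eq_sub_of_hasDerivAt (fun y _ => key y) (continuous_quarticWeight.intervalIntegrable _ _)]
  -- At `y = 1` the two arguments are reciprocal, so the arctangents add to `π / 2`; at `y = 0` they
  -- are `1` and `-1` and cancel.
  have h1 : Real.arctan (√2 + 1) + Real.arctan (√2 - 1) = Real.pi / 2 := by
    have : √2 - 1 = (√2 + 1)⁻¹ := by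
      refine eq_inv_of_mul_eq_one_left ?_; linear_combination s2
    rw [this, Real.arctan_inv_of_pos (by positivity)]
    ring
  simp only [mul_one, mul_zero, zero_add, zero_sub, Real.arctan_neg, h1]
  field_simp
  ring

/-- The inversion `v ↦ 1 / v` preserves `dv / (1 + v²)` and changes the sign of `log v`, so the
integral equals its own negative. -/
theorem integral_log_ratio_eq_zero :
    ∫ v in Ioi (0 : ℝ), Real.log v / (1 + v ^ 2) = 0 := by
  have him : Set.image (fun v : ℝ => v⁻¹) (Ioi 0) = Ioi 0 := by
    ext v
    constructor
    · rintro ⟨u, hu, rfl⟩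
      exact inv_pos.mpr (mem_Ioi.mp hu)
    · intro hv
      exact ⟨v⁻¹, inv_pos.mpr (mem_Ioi.mp hv), inv_inv v⟩
  have h := integral_image_eq_integral_abs_deriv_smul (s := Ioi (0 : ℝ)) (f := fun v => v⁻¹)
    (f' := fun v => -(v ^ 2)⁻¹) measurableSet_Ioi
    (fun v hv => (hasDerivAt_inv (mem_Ioi.mp hv).ne').hasDerivWithinAt)
    (inv_injective.injOn) (fun v => Real.log v / (1 + v ^ 2))
  rw [him] at h
  have e : ∫ v in Ioi (0 : ℝ), |-(v ^ 2)⁻¹| • (Real.log v⁻¹ / (1 + v⁻¹ ^ 2)) =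
      ∫ v in Ioi (0 : ℝ), -(Real.log v / (1 + v ^ 2)) := by
    refine setIntegral_congr_fun measurableSet_Ioi fun v hv => ?_
    have hv0 : v ≠ 0 := (mem_Ioi.mp hv).ne'
    simp only [smul_eq_mul, abs_neg, abs_inv, Real.log_inv]
    rw [abs_of_pos (by positivity)]
    have : v ^ 2 + 1 ≠ 0 := by positivity
    have : 1 + v ^ 2 ≠ 0 := by positivity
    field_simp
    ring
  rw [e, MeasureTheory.integral_neg] at h
  linarith

theorem image_quartic_substitution :
    Set.image (fun y : ℝ => (1 - y ^ 2) / (√2 * y)) (Ioo 0 1) = Ioi 0 := by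
  have s2 : √2 ^ 2 = (2 : ℝ) := Real.sq_sqrt (by norm_num)
  ext v
  constructor
  · rintro ⟨y, hy, rfl⟩
    have h0 := hy.1
    have h1 := hy.2
    have h2 : 0 < 1 - y ^ 2 := by nlinarith
    exact mem_Ioi.mpr (div_pos h2 (by positivity))
  · intro hv
    have hv : 0 < v := hv
    have hr : √(v ^ 2 + 2) ^ 2 = v ^ 2 + 2 := Real.sq_sqrt (by positivity)
    have hr0 : 0 < √(v ^ 2 + 2) := by positivity
    have hs0 : 0 < √(2 : ℝ) := by positivity
    set r := √(v ^ 2 + 2)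
    have hlt : v < r := by nlinarith
    have hle : r - v < √2 := by nlinarith
    -- The preimage is the positive root of `y² + √2 v y - 1 = 0`.
    refine ⟨(r - v) / √2, ⟨by apply div_pos <;> linarith, by rw [div_lt_one hs0]; exact hle⟩, ?_⟩
    have h1 : r - v ≠ 0 := by linarith
    simp only
    rw [div_pow, s2, mul_div_cancel₀ _ hs0.ne', div_eq_iff h1]
    linear_combination (-1 / 2 : ℝ) * hr

/-- For `v = (1 - y²) / (√2 y)` one has `1 + v² = (1 + y⁴) / (2y²)`, so `|dv| / (1 + v²) = √2 w dy`
and the integral becomes the vanishing one over `(0, ∞)`. -/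
theorem integral_quarticWeight_mul_log_ratio :
    ∫ y in (0 : ℝ)..1, quarticWeight y * Real.log ((1 - y ^ 2) / (√2 * y)) = 0 := by
  have s2 : √2 ^ 2 = (2 : ℝ) := Real.sq_sqrt (by norm_num)
  have hs0 : 0 < √(2 : ℝ) := by positivity
  have h := integral_image_eq_integral_abs_deriv_smul (s := Ioo (0 : ℝ) 1)
    (f := fun y => (1 - y ^ 2) / (√2 * y)) (f' := fun y => -((1 + y ^ 2) / (√2 * y ^ 2)))
    measurableSet_Ioo (fun y hy => by
      have hy0 : y ≠ 0 := hy.1.ne'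
      have := ((hasDerivAt_pow 2 y).const_sub 1).div ((hasDerivAt_id' y).const_mul √2)
        (by positivity)
      refine (this.congr_deriv ?_).hasDerivWithinAt
      field_simp
      ring)
    (fun a ha b hb hab => by
      have ha0 := ha.1
      have hb0 := hb.1
      have h' : (1 - a ^ 2) / (√2 * a) = (1 - b ^ 2) / (√2 * b) := hab
      rw [div_eq_div_iff (by positivity) (by positivity)] at h'
      have h2 : √2 * ((1 + a * b) * (b - a)) = 0 := by linear_combination h'
      rcases mul_eq_zero.mp h2 with h3 | h3
      · exact absurd h3 hs0.ne'
      · rcases mul_eq_zero.mp h3 with h4 | h4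
        · nlinarith [mul_pos ha0 hb0]
        · linarith)
    (fun v => Real.log v / (1 + v ^ 2))
  rw [image_quartic_substitution, integral_log_ratio_eq_zero] at h
  rw [integral_of_le zero_le_one, integral_Ioc_eq_integral_Ioo]
  have e : ∫ y in Ioo (0 : ℝ) 1, |-((1 + y ^ 2) / (√2 * y ^ 2))| •
      (Real.log ((1 - y ^ 2) / (√2 * y)) / (1 + ((1 - y ^ 2) / (√2 * y)) ^ 2)) =
      ∫ y in Ioo (0 : ℝ) 1, √2 * (quarticWeight y * Real.log ((1 - y ^ 2) / (√2 * y))) := by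
    refine setIntegral_congr_fun measurableSet_Ioo fun y hy => ?_
    have hy0 : 0 < y := hy.1
    simp only [smul_eq_mul, abs_neg, quarticWeight]
    rw [abs_of_pos (by positivity)]
    have e1 : 1 + ((1 - y ^ 2) / (√2 * y)) ^ 2 = (1 + y ^ 4) / (2 * y ^ 2) := by
      rw [div_pow, mul_pow, s2]
      field_simp
      ring
    rw [e1]
    generalize Real.log ((1 - y ^ 2) / (√2 * y)) = l
    have := (one_add_pow_four_pos y).ne'
    field_simp
    rw [s2, mul_comm]
  rw [e, MeasureTheory.integral_const_mul] at h
  exact (mul_eq_zero.mp h.symm).resolve_left hs0.ne'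

theorem intervalIntegrable_quarticWeight_mul_log :
    IntervalIntegrable (fun y => quarticWeight y * Real.log y) volume 0 1 :=
  intervalIntegrable_log'.continuousOn_mul continuous_quarticWeight.continuousOn

theorem intervalIntegrable_quarticWeight_mul_log_one_sub_sq :
    IntervalIntegrable (fun y => quarticWeight y * Real.log (1 - y ^ 2)) volume 0 1 :=
  intervalIntegrable_log_one_sub_sq.continuousOn_mul continuous_quarticWeight.continuousOn

theorem integral_quarticWeight_mul_log_one_sub_sq :
    ∫ y in (0 : ℝ)..1, quarticWeight y * Real.log (1 - y ^ 2) =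
      (∫ y in (0 : ℝ)..1, quarticWeight y * Real.log y) +
        Real.log 2 / 2 * (Real.pi / (2 * √2)) := by
  have h := integral_quarticWeight_mul_log_ratio
  have e : ∫ y in (0 : ℝ)..1, quarticWeight y * Real.log ((1 - y ^ 2) / (√2 * y)) =
      ∫ y in (0 : ℝ)..1, (quarticWeight y * Real.log (1 - y ^ 2) - quarticWeight y * Real.log y -
        Real.log 2 / 2 * quarticWeight y) := by
    refine integral_congr_uIoo fun y hy => ?_
    rw [uIoo_of_le zero_le_one] at hy
    have hy0 := hy.1
    have h1 : 1 - y ^ 2 ≠ 0 := by nlinarith [hy.1, hy.2]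
    rw [Real.log_div h1 (by positivity), Real.log_mul (by positivity) hy0.ne',
      Real.log_sqrt (by norm_num)]
    ring
  rw [e, intervalIntegral.integral_sub
    (intervalIntegrable_quarticWeight_mul_log_one_sub_sq.sub intervalIntegrable_quarticWeight_mul_log)
    ((continuous_quarticWeight.intervalIntegrable _ _).const_mul _),
    intervalIntegral.integral_sub
    intervalIntegrable_quarticWeight_mul_log_one_sub_sq intervalIntegrable_quarticWeight_mul_log,
    intervalIntegral.integral_const_mul, integral_quarticWeight] at h
  linarith

/-! ### A rational function with vanishing integral. -/

/-- The function `(1 - y²) / (1 + y⁴) - 1 / (2 - y²)`, whose integral over `[0, 1]` vanishes. -/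
noncomputable def nullWeight (y : ℝ) : ℝ := (1 - y ^ 2) / (1 + y ^ 4) - 1 / (2 - y ^ 2)

theorem two_sub_sq_pos {y : ℝ} (hy : y ∈ Icc (0 : ℝ) 1) : 0 < 2 - y ^ 2 := by
  nlinarith [hy.1, hy.2]

theorem continuousOn_nullWeight : ContinuousOn nullWeight (Icc 0 1) :=
  (ContinuousOn.div (by fun_prop) (by fun_prop) fun y _ => (one_add_pow_four_pos y).ne').sub
    (ContinuousOn.div (by fun_prop) (by fun_prop) fun _ hy => (two_sub_sq_pos hy).ne')

theorem integral_nullWeight : ∫ y in (0 : ℝ)..1, nullWeight y = 0 := by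
  have s2 : √2 ^ 2 = (2 : ℝ) := Real.sq_sqrt (by norm_num)
  have s0 : 0 < √(2 : ℝ) := by positivity
  have s1 : 1 < √(2 : ℝ) := by nlinarith
  have key : ∀ y ∈ Icc (0 : ℝ) 1, HasDerivAt (fun y => (Real.log (1 + √2 * y + y ^ 2) -
      Real.log (1 - √2 * y + y ^ 2) - Real.log (√2 + y) + Real.log (√2 - y)) / (2 * √2))
      (nullWeight y) y := by
    intro y hy
    have h0 := hy.1
    have h1 := hy.2
    have p1 : 1 + √2 * y + y ^ 2 ≠ 0 := by positivity
    have p2 : 1 - √2 * y + y ^ 2 ≠ 0 := by nlinarith [sq_nonneg (√2 * y - 1)]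
    have p3 : √2 + y ≠ 0 := by positivity
    have p4 : √2 - y ≠ 0 := by linarith
    have d := (hasDerivAt_id' y).const_mul √2
    have dd := hasDerivAt_pow 2 y
    refine ((((((d.const_add 1).add dd).log p1).sub (((d.const_sub 1).add dd).log p2)).sub
      (((hasDerivAt_id' y).const_add √2).log p3)).add
      (((hasDerivAt_id' y).const_sub √2).log p4)).div_const (2 * √2) |>.congr_deriv ?_
    simp only [Pi.add_apply]
    have e1 : 1 + y ^ 4 = (1 + √2 * y + y ^ 2) * (1 - √2 * y + y ^ 2) := by
      linear_combination y ^ 2 * s2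
    have e2 : 2 - y ^ 2 = (√2 + y) * (√2 - y) := by linear_combination - s2
    have f1 : (√2 * 1 + ((2 : ℕ) : ℝ) * y ^ (2 - 1)) / (1 + √2 * y + y ^ 2) -
        (-(√2 * 1) + ((2 : ℕ) : ℝ) * y ^ (2 - 1)) / (1 - √2 * y + y ^ 2) =
        2 * √2 * ((1 - y ^ 2) / (1 + y ^ 4)) := by
      rw [e1, div_sub_div _ _ p1 p2, ← mul_div_assoc]
      congr 1
      norm_num
      ring
    have f2 : 1 / (√2 + y) - -1 / (√2 - y) = 2 * √2 * (1 / (2 - y ^ 2)) := by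
      rw [e2, div_sub_div _ _ p3 p4, ← mul_div_assoc]
      congr 1
      ring
    rw [nullWeight, div_eq_iff (by positivity)]
    linear_combination f1 - f2
  rw [integral_eq_sub_of_hasDerivAt (fun y hy => key y (by rwa [uIcc_of_le zero_le_one] at hy))
    (by
      apply ContinuousOn.intervalIntegrable
      rw [uIcc_of_le zero_le_one]
      exact continuousOn_nullWeight)]
  -- At `y = 1` the quadratic factors become `√2 (√2 ± 1)`, so their logarithms cancel against those
  -- of `√2 ± 1`.
  have e1 : (1 + √2 * 1 + 1 ^ 2 : ℝ) = √2 * (√2 + 1) := by linear_combination - s2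
  have e2 : (1 - √2 * 1 + 1 ^ 2 : ℝ) = √2 * (√2 - 1) := by linear_combination - s2
  rw [e1, e2, Real.log_mul s0.ne' (by positivity), Real.log_mul s0.ne' (by linarith)]
  simp

/-! ### The L-value as an integral of w against log y. -/

/-- Since `w = (1 + y²)(1 - y⁴) / (1 - y⁸)`, the expansion of `w` has signs `+, +, -, -` at
exponents `0, 2, 4, 6` modulo 8. Multiplying by `log y` and integrating shifts these to the residues
`1, 3, 5, 7`, with the signs of the character. -/
theorem quarticWeight_mul_one_sub_pow (N : ℕ) (y : ℝ) :
    quarticWeight y * (1 - y ^ (8 * N)) =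
      ∑ n ∈ Finset.range N, (y ^ (8 * n) + y ^ (8 * n + 2) - y ^ (8 * n + 4) - y ^ (8 * n + 6)) := by
  have := (one_add_pow_four_pos y).ne'
  induction N with
  | zero => simp
  | succ N ih =>
    rw [Finset.sum_range_succ, ← ih, quarticWeight]
    field_simp
    ring

theorem hasSum_kroneckerSymbol_nat :
    HasSum (fun n : ℕ => ((ZMod.χ₈' (n : ZMod 8) : ℤ) : ℝ) / (n : ℝ) ^ 2) LTwoNegEight := by
  have h := summable_kroneckerSymbol_neg_eight.hasSum
  have h' : HasSum (fun n : ℕ+ => ((ZMod.χ₈' ((n : ℕ) : ZMod 8) : ℤ) : ℝ) / ((n : ℕ) : ℝ) ^ 2)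
      LTwoNegEight := by
    rw [← LTwoNegEight] at h
    simpa only [kroneckerSymbol_neg_eight] using h
  refine (PNat.coe_injective.hasSum_iff (f := fun n : ℕ =>
    ((ZMod.χ₈' (n : ZMod 8) : ℤ) : ℝ) / (n : ℝ) ^ 2) ?_).mp h'
  -- Only `n = 0` is missed by the positive naturals, and its term is 0.
  intro n hn
  have : n = 0 := by
    by_contra h0
    exact hn ⟨⟨n, Nat.pos_of_ne_zero h0⟩, rfl⟩
  simp [this]

theorem sum_range_kroneckerSymbol (N : ℕ) :
    ∑ n ∈ Finset.range (8 * N), ((ZMod.χ₈' (n : ZMod 8) : ℤ) : ℝ) / (n : ℝ) ^ 2 =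
      ∑ n ∈ Finset.range N, (1 / (8 * (n : ℝ) + 1) ^ 2 + 1 / (8 * (n : ℝ) + 3) ^ 2 -
        1 / (8 * (n : ℝ) + 5) ^ 2 - 1 / (8 * (n : ℝ) + 7) ^ 2) := by
  induction N with
  | zero => simp
  | succ N ih =>
    rw [mul_add, mul_one, Finset.sum_range_add, ih, Finset.sum_range_succ]
    have h8 : (8 : ZMod 8) = 0 := by decide
    have c0 : ZMod.χ₈' 0 = 0 := by decide
    have c1 : ZMod.χ₈' 1 = 1 := by decide
    have c2 : ZMod.χ₈' 2 = 0 := by decide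
    have c3 : ZMod.χ₈' 3 = 1 := by decide
    have c4 : ZMod.χ₈' 4 = 0 := by decide
    have c5 : ZMod.χ₈' 5 = -1 := by decide
    have c6 : ZMod.χ₈' 6 = 0 := by decide
    have c7 : ZMod.χ₈' 7 = -1 := by decide
    simp only [Finset.sum_range_succ, Finset.sum_range_zero]
    push_cast
    simp only [h8, zero_mul, zero_add, add_zero, c0, c1, c2, c3, c4, c5, c6, c7]
    push_cast
    ring

theorem integral_quarticWeight_mul_log :
    ∫ y in (0 : ℝ)..1, quarticWeight y * Real.log y = -LTwoNegEight := by
  have hpl (n : ℕ) : IntervalIntegrable (fun y : ℝ => y ^ n * Real.log y) volume 0 1 :=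
    intervalIntegrable_log'.continuousOn_mul (by fun_prop)
  have hlim : Filter.Tendsto (fun N : ℕ => ∑ n ∈ Finset.range (8 * N),
      ((ZMod.χ₈' (n : ZMod 8) : ℤ) : ℝ) / (n : ℝ) ^ 2) Filter.atTop (nhds LTwoNegEight) :=
    hasSum_kroneckerSymbol_nat.tendsto_sum_nat.comp
      (Filter.tendsto_atTop_mono (fun N => by rw [id]; omega) Filter.tendsto_id)
  have hid (N : ℕ) : ∑ n ∈ Finset.range (8 * N), ((ZMod.χ₈' (n : ZMod 8) : ℤ) : ℝ) / (n : ℝ) ^ 2 =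
      -(∫ y in (0 : ℝ)..1, quarticWeight y * Real.log y) +
        ∫ y in (0 : ℝ)..1, quarticWeight y * (y ^ (8 * N) * Real.log y) := by
    rw [sum_range_kroneckerSymbol]
    have e : ∫ y in (0 : ℝ)..1, (quarticWeight y * Real.log y -
        quarticWeight y * (y ^ (8 * N) * Real.log y)) =
        ∫ y in (0 : ℝ)..1, ∑ n ∈ Finset.range N, (y ^ (8 * n) * Real.log y +
          y ^ (8 * n + 2) * Real.log y - y ^ (8 * n + 4) * Real.log y -
          y ^ (8 * n + 6) * Real.log y) := by
      congr 1
      ext y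
      have := quarticWeight_mul_one_sub_pow N y
      calc _ = quarticWeight y * (1 - y ^ (8 * N)) * Real.log y := by ring
        _ = _ := by
          rw [this, Finset.sum_mul]
          exact Finset.sum_congr rfl fun n _ => by ring
    rw [intervalIntegral.integral_sub intervalIntegrable_quarticWeight_mul_log
      ((hpl _).continuousOn_mul continuous_quarticWeight.continuousOn),
      intervalIntegral.integral_finsetSum
        (fun n _ => (((hpl _).add (hpl _)).sub (hpl _)).sub (hpl _))] at e
    have e2 : ∀ n ∈ Finset.range N, ∫ y in (0 : ℝ)..1, (y ^ (8 * n) * Real.log y +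
          y ^ (8 * n + 2) * Real.log y - y ^ (8 * n + 4) * Real.log y -
          y ^ (8 * n + 6) * Real.log y) = -(1 / (8 * (n : ℝ) + 1) ^ 2 + 1 / (8 * (n : ℝ) + 3) ^ 2 -
        1 / (8 * (n : ℝ) + 5) ^ 2 - 1 / (8 * (n : ℝ) + 7) ^ 2) := by
      intro n _
      rw [intervalIntegral.integral_sub (((hpl _).add (hpl _)).sub (hpl _)) (hpl _),
        intervalIntegral.integral_sub ((hpl _).add (hpl _)) (hpl _),
        intervalIntegral.integral_add (hpl _) (hpl _), integral_pow_mul_log, integral_pow_mul_log,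
        integral_pow_mul_log, integral_pow_mul_log]
      push_cast
      ring
    rw [Finset.sum_congr rfl e2, Finset.sum_neg_distrib] at e
    linarith
  have hrem : Filter.Tendsto (fun N : ℕ => ∫ y in (0 : ℝ)..1,
      quarticWeight y * (y ^ (8 * N) * Real.log y)) Filter.atTop (nhds 0) := by
    -- Bounding `w` by 2 leaves the moment of `-log y`, equal to `1 / (8N + 1)²`; the weaker `1 / (N
    -- + 1)` is enough for the limit.
    have hb (N : ℕ) : ‖∫ y in (0 : ℝ)..1, quarticWeight y * (y ^ (8 * N) * Real.log y)‖ ≤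
        2 * (1 / ((N : ℝ) + 1)) := by
      have h1 := intervalIntegral.norm_integral_le_of_norm_le (μ := volume) (a := 0) (b := 1)
        (f := fun y => quarticWeight y * (y ^ (8 * N) * Real.log y))
        (g := fun y => -2 * (y ^ (8 * N) * Real.log y)) zero_le_one
        (Filter.Eventually.of_forall fun y hy => by
          have hl : Real.log y ≤ 0 := Real.log_nonpos hy.1.le hy.2
          have hq : |quarticWeight y| ≤ 2 := by
            rw [quarticWeight, abs_of_nonneg (by positivity), div_le_iff₀ (by positivity)]
            nlinarith [sq_nonneg (y ^ 2 - 1), sq_nonneg (y ^ 2)]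
          have hp : 0 ≤ -(y ^ (8 * N) * Real.log y) := by
            have := pow_nonneg hy.1.le (8 * N)
            nlinarith
          rw [norm_mul, Real.norm_eq_abs, Real.norm_eq_abs, ← abs_neg (_ * Real.log y),
            abs_of_nonneg hp]
          nlinarith) ((hpl _).const_mul _)
      refine h1.trans ?_
      rw [intervalIntegral.integral_const_mul, integral_pow_mul_log]
      have hN : (0 : ℝ) ≤ N := Nat.cast_nonneg N
      have : 1 / ((8 * N : ℕ) + 1 : ℝ) ^ 2 ≤ 1 / ((N : ℝ) + 1) := by
        push_cast
        apply one_div_le_one_div_of_le (by positivity)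
        nlinarith
      calc _ = 2 * (1 / ((8 * N : ℕ) + 1 : ℝ) ^ 2) := by ring
        _ ≤ _ := by linarith
    refine squeeze_zero_norm hb ?_
    simpa using tendsto_one_div_add_atTop_nhds_zero_nat.const_mul (2 : ℝ)
  have h2 := hrem.const_add (-(∫ y in (0 : ℝ)..1, quarticWeight y * Real.log y))
  simp only [← hid, add_zero] at h2
  linarith [tendsto_nhds_unique hlim h2]

theorem integral_quarticWeight_mul_logFactor (c : ℝ) :
    ∫ y in (0 : ℝ)..1, quarticWeight y * logFactor c y =
      3 / 2 * c * Real.log 2 * (Real.pi / (2 * √2)) - (2 - c) * LTwoNegEight := by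
  have e : (fun y => quarticWeight y * logFactor c y) = fun y =>
      2 * c * Real.log 2 * quarticWeight y + 2 * (quarticWeight y * Real.log y) -
        c * (quarticWeight y * Real.log (1 - y ^ 2)) := by
    ext y; rw [logFactor]; ring
  have i1 := (continuous_quarticWeight.intervalIntegrable (μ := volume) 0 1)
  have i2 := intervalIntegrable_quarticWeight_mul_log
  have i3 := intervalIntegrable_quarticWeight_mul_log_one_sub_sq
  rw [e, intervalIntegral.integral_sub ((i1.const_mul _).add (i2.const_mul _)) (i3.const_mul _),
    intervalIntegral.integral_add (i1.const_mul _) (i2.const_mul _),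
    intervalIntegral.integral_const_mul, intervalIntegral.integral_const_mul,
    intervalIntegral.integral_const_mul, integral_quarticWeight,
    integral_quarticWeight_mul_log_one_sub_sq, integral_quarticWeight_mul_log]
  ring

/-! ### Summation under the integral sign. -/

/-- The common denominator `(2 - y²)(1 + y⁴)`. -/
noncomputable def sexticDenom (y : ℝ) : ℝ := (2 - y ^ 2) * (1 + y ^ 4)

theorem sexticDenom_pos {y : ℝ} (hy : y ∈ Icc (0 : ℝ) 1) : 0 < sexticDenom y :=
  mul_pos (two_sub_sq_pos hy) (one_add_pow_four_pos y)

theorem continuous_sexticDenom : Continuous sexticDenom := by unfold sexticDenom; fun_prop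

/-- The sum over `k` of `(a + b (k + 1) + c (k + 1)(k + 2) / 2) * weightKernel k y`. -/
noncomputable def sumKernel (a b c y : ℝ) : ℝ :=
  2 * (y ^ 2 * (1 - y ^ 2)) *
    (2 * a / sexticDenom y + 4 * b / sexticDenom y ^ 2 + 8 * c / sexticDenom y ^ 3)

theorem continuousOn_sumKernel (a b c : ℝ) : ContinuousOn (sumKernel a b c) (Icc 0 1) := by
  have h := continuous_sexticDenom.continuousOn (s := Icc (0 : ℝ) 1)
  refine ContinuousOn.mul (by fun_prop) (((ContinuousOn.div (by fun_prop) h fun y hy => ?_).add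
    (ContinuousOn.div (by fun_prop) (h.pow 2) fun y hy => ?_)).add
    (ContinuousOn.div (by fun_prop) (h.pow 3) fun y hy => ?_))
  · exact (sexticDenom_pos hy).ne'
  · exact pow_ne_zero _ (sexticDenom_pos hy).ne'
  · exact pow_ne_zero _ (sexticDenom_pos hy).ne'

/-- Quadratic polynomials in `k`, expanded so that their generating functions are immediate. -/
noncomputable def quadCoeff (a b c : ℝ) (k : ℕ) : ℝ :=
  a + b * ((k : ℝ) + 1) + c * (((k : ℝ) + 1) * (k + 2) / 2)

theorem hasSum_quadCoeff_mul_pow (a b c : ℝ) {z : ℝ} (hz : ‖z‖ < 1) :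
    HasSum (fun k => quadCoeff a b c k * z ^ k)
      (a / (1 - z) + b / (1 - z) ^ 2 + c / (1 - z) ^ 3) := by
  have h0 := (hasSum_choose_mul_geometric_of_norm_lt_one 0 hz).mul_left a
  have h1 := (hasSum_choose_mul_geometric_of_norm_lt_one 1 hz).mul_left b
  have h2 := (hasSum_choose_mul_geometric_of_norm_lt_one 2 hz).mul_left c
  have e : (fun k => quadCoeff a b c k * z ^ k) = fun k : ℕ =>
      a * (((k + 0).choose 0 : ℕ) * z ^ k) + b * (((k + 1).choose 1 : ℕ) * z ^ k) +
        c * (((k + 2).choose 2 : ℕ) * z ^ k) := by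
    ext k
    rw [quadCoeff, Nat.cast_choose_two]
    simp only [Nat.choose_zero_right, Nat.choose_one_right]
    push_cast
    ring
  have e' : a / (1 - z) + b / (1 - z) ^ 2 + c / (1 - z) ^ 3 = a * (1 / (1 - z) ^ (0 + 1)) +
      b * (1 / (1 - z) ^ (1 + 1)) + c * (1 / (1 - z) ^ (2 + 1)) := by ring
  rw [e, e']
  exact (h0.add h1).add h2

theorem weightKernel_eq (k : ℕ) (y : ℝ) :
    weightKernel k y = 2 * (y ^ 2 * (1 - y ^ 2)) * (y ^ 2 * (1 - y ^ 2) ^ 2 / 2) ^ k := by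
  rw [weightKernel, div_pow _ _ k, mul_pow (y ^ 2), ← pow_mul, ← pow_mul, one_div, inv_pow,
    pow_succ (2 : ℝ)]
  field_simp
  ring

theorem kernelRatio_mem {y : ℝ} (hy : y ∈ Icc (0 : ℝ) 1) :
    0 ≤ y ^ 2 * (1 - y ^ 2) ^ 2 / 2 ∧ y ^ 2 * (1 - y ^ 2) ^ 2 / 2 ≤ 1 / 2 := by
  have h1 : y ^ 2 ≤ 1 := pow_le_one₀ hy.1 hy.2
  have h0 : 0 ≤ y ^ 2 := sq_nonneg y
  refine ⟨by positivity, ?_⟩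
  have : y ^ 2 * (1 - y ^ 2) ^ 2 ≤ 1 * 1 :=
    mul_le_mul h1 (pow_le_one₀ (by linarith) (by linarith)) (sq_nonneg _) zero_le_one
  linarith

theorem hasSum_quadCoeff_mul_weightKernel (a b c : ℝ) {y : ℝ} (hy : y ∈ Icc (0 : ℝ) 1) :
    HasSum (fun k => quadCoeff a b c k * weightKernel k y) (sumKernel a b c y) := by
  obtain ⟨h0, h1⟩ := kernelRatio_mem hy
  have h := (hasSum_quadCoeff_mul_pow a b c (z := y ^ 2 * (1 - y ^ 2) ^ 2 / 2)
    (by rw [Real.norm_eq_abs, abs_of_nonneg h0]; linarith)).mul_left (2 * (y ^ 2 * (1 - y ^ 2)))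
  have hD := (sexticDenom_pos hy).ne'
  have e : 1 - y ^ 2 * (1 - y ^ 2) ^ 2 / 2 = sexticDenom y / 2 := by rw [sexticDenom]; ring
  have e1 : (fun k => quadCoeff a b c k * weightKernel k y) = fun k =>
      2 * (y ^ 2 * (1 - y ^ 2)) * (quadCoeff a b c k * (y ^ 2 * (1 - y ^ 2) ^ 2 / 2) ^ k) := by
    ext k; rw [weightKernel_eq]; ring
  have e2 : sumKernel a b c y = 2 * (y ^ 2 * (1 - y ^ 2)) * (a / (sexticDenom y / 2) +
      b / (sexticDenom y / 2) ^ 2 + c / (sexticDenom y / 2) ^ 3) := by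
    rw [sumKernel]
    field_simp
    ring
  rw [e] at h
  rw [e1, e2]
  exact h

/-- Dominated convergence: the geometric ratio is at most `1 / 2` on `[0, 1]`, so the terms are
bounded by `|quadCoeff| 2 ^ (-k) · 2|g|`, summable in `k` and integrable in `y`. -/
theorem hasSum_integral_weightKernel (a b c : ℝ) {g : ℝ → ℝ}
    (hg : IntervalIntegrable g volume 0 1) :
    HasSum (fun k => quadCoeff a b c k * ∫ y in (0 : ℝ)..1, weightKernel k y * g y)
      (∫ y in (0 : ℝ)..1, sumKernel a b c y * g y) := by
  have hS : Summable fun k => |quadCoeff a b c k| * (1 / 2) ^ k := by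
    have := (hasSum_quadCoeff_mul_pow a b c (z := 1 / 2) (by norm_num)).summable.abs
    refine this.congr fun k => ?_
    rw [abs_mul, abs_of_pos (by positivity : (0 : ℝ) < (1 / 2) ^ k)]
  have h := intervalIntegral.hasSum_integral_of_dominated_convergence (μ := volume) (a := 0) (b := 1)
    (F := fun k y => quadCoeff a b c k * (weightKernel k y * g y))
    (f := fun y => sumKernel a b c y * g y)
    (fun k y => |quadCoeff a b c k| * (1 / 2) ^ k * (2 * |g y|)) ?_ ?_ ?_ ?_ ?_
  · simpa only [intervalIntegral.integral_const_mul] using h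
  · intro k
    exact (intervalIntegrable_iff.mp ((hg.continuousOn_mul
      (continuous_weightKernel k).continuousOn).const_mul _)).aestronglyMeasurable
  · intro k
    refine Filter.Eventually.of_forall fun y hy => ?_
    rw [uIoc_of_le zero_le_one] at hy
    have hy' : y ∈ Icc (0 : ℝ) 1 := ⟨hy.1.le, hy.2⟩
    obtain ⟨h0, h1⟩ := kernelRatio_mem hy'
    have h2 : y ^ 2 ≤ 1 := pow_le_one₀ hy'.1 hy'.2
    have h3 : 0 ≤ y ^ 2 * (1 - y ^ 2) := mul_nonneg (sq_nonneg y) (by linarith)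
    have h4 : y ^ 2 * (1 - y ^ 2) ≤ 1 := by nlinarith [sq_nonneg y]
    have hk : |weightKernel k y| ≤ 2 * (1 / 2) ^ k := by
      rw [weightKernel_eq, abs_of_nonneg (by positivity)]
      exact mul_le_mul (by linarith) (pow_le_pow_left₀ h0 h1 k) (by positivity) (by norm_num)
    rw [norm_mul, norm_mul, Real.norm_eq_abs, Real.norm_eq_abs, Real.norm_eq_abs]
    calc |quadCoeff a b c k| * (|weightKernel k y| * |g y|)
        ≤ |quadCoeff a b c k| * (2 * (1 / 2) ^ k * |g y|) := by gcongr
      _ = _ := by ring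
  · exact Filter.Eventually.of_forall fun y _ => hS.mul_right _
  · simp only [tsum_mul_right]
    exact (hg.abs.const_mul 2).const_mul _
  · refine Filter.Eventually.of_forall fun y hy => ?_
    rw [uIoc_of_le zero_le_one] at hy
    have h := (hasSum_quadCoeff_mul_weightKernel a b c ⟨hy.1.le, hy.2⟩).mul_right (g y)
    simpa only [mul_assoc] using h

/-! ### Integration by parts against the logarithmic factor. -/

/-- Integration of `R log + C` by parts, where `R` and `C` are rational functions whose
antiderivatives are rational up to multiples of `quarticWeight` and `nullWeight`. -/
theorem integral_mul_logFactor_add {c q α β γ : ℝ} {R C Q N M T : ℝ → ℝ}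
    (hR : ContinuousOn R (Icc 0 1)) (hC : ContinuousOn C (Icc 0 1))
    (hN : ContinuousOn N (Icc 0 1)) (hM : ContinuousOn M (Icc 0 1))
    (hT : ContinuousOn T (Icc 0 1))
    (hQN : ∀ y, Q y = y * N y) (hQM : ∀ y ∈ Icc (0 : ℝ) 1, Q y - q = (1 - y) * M y)
    (hQ' : ∀ y ∈ Ioo (0 : ℝ) 1, HasDerivAt Q (R y - α * quarticWeight y) y)
    (hT' : ∀ y ∈ Ioo (0 : ℝ) 1, HasDerivAt T (C y - Q y * (2 / y + 2 * c * y / (1 - y ^ 2)) +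
      2 * c * q / (1 - y ^ 2) - β * quarticWeight y - γ * nullWeight y) y) :
    (∫ y in (0 : ℝ)..1, R y * logFactor c y) + ∫ y in (0 : ℝ)..1, C y =
      T 1 - T 0 + α * (3 / 2 * c * Real.log 2 * (Real.pi / (2 * √2)) - (2 - c) * LTwoNegEight) +
        β * (Real.pi / (2 * √2)) := by
  have hI : uIcc (0 : ℝ) 1 = Icc 0 1 := uIcc_of_le zero_le_one
  have iR : IntervalIntegrable (fun y => R y * logFactor c y) volume 0 1 :=
    (intervalIntegrable_logFactor c).continuousOn_mul (by rwa [hI])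
  have iC : IntervalIntegrable C volume 0 1 := ContinuousOn.intervalIntegrable (by rwa [hI])
  have iW : IntervalIntegrable (fun y => quarticWeight y * logFactor c y) volume 0 1 :=
    (intervalIntegrable_logFactor c).continuousOn_mul continuous_quarticWeight.continuousOn
  have iw : IntervalIntegrable quarticWeight volume 0 1 :=
    continuous_quarticWeight.intervalIntegrable _ _
  have ih : IntervalIntegrable nullWeight volume 0 1 :=
    ContinuousOn.intervalIntegrable (by rw [hI]; exact continuousOn_nullWeight)
  have hQc : ContinuousOn Q (Icc 0 1) :=
    (continuousOn_id.mul hN).congr fun y _ => hQN y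
  -- This is `Q · logFactor c + c q log ((1 - y) / (1 + y)) + T`, regrouped. Since `Q` vanishes at 0
  -- but equals `q` at 1, the added term makes the coefficient of `log (1 - y)` equal to a multiple
  -- of `Q - q`, which removes the singularity at 1; its derivative accounts for `2cq / (1 - y²)` in
  -- `hT'`. The remaining `log 2` terms at 1, `2cq log 2` and `-c(q + q) log 2`, cancel.
  have hcont : ContinuousOn (fun y => 2 * (N y * (y * Real.log y)) + 2 * c * Real.log 2 * Q y -
      c * (M y * ((1 - y) * Real.log (1 - y))) - c * ((Q y + q) * Real.log (1 + y)) + T y)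
      (Icc 0 1) := by
    have l1 : ContinuousOn (fun y : ℝ => (1 - y) * Real.log (1 - y)) (Icc 0 1) :=
      (Real.continuous_mul_log.comp (by fun_prop : Continuous fun y : ℝ => 1 - y)).continuousOn
    have l2 : ContinuousOn (fun y : ℝ => Real.log (1 + y)) (Icc 0 1) :=
      ContinuousOn.log (by fun_prop) fun y hy => by linarith [hy.1]
    exact (((((hN.mul Real.continuous_mul_log.continuousOn).const_mul 2).add
      (hQc.const_mul _)).sub ((hM.mul l1).const_mul c)).sub
      (((hQc.add continuousOn_const).mul l2).const_mul c)).add hT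
  have hF := integral_eq_sub_of_hasDerivAt_of_le zero_le_one hcont
    (f' := fun y => R y * logFactor c y + C y - α * (quarticWeight y * logFactor c y) -
      β * quarticWeight y - γ * nullWeight y) (fun y hy => by
      have h0 : y ≠ 0 := hy.1.ne'
      have h1 : 1 - y ≠ 0 := by linarith [hy.2]
      have h2 : 1 + y ≠ 0 := by linarith [hy.1]
      have d1 := (hasDerivAt_id' y).const_sub 1
      have d2 := (hasDerivAt_id' y).const_add 1
      have hd := (((((hQ' y hy).mul (Real.hasDerivAt_log h0)).const_mul 2).add
        ((hQ' y hy).const_mul (2 * c * Real.log 2))).sub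
        ((((hQ' y hy).sub_const q).mul (d1.log h1)).const_mul c)).sub
        ((((hQ' y hy).add_const q).mul (d2.log h2)).const_mul c) |>.add (hT' y hy)
      refine (hd.congr_of_eventuallyEq ?_).congr_deriv ?_
      · filter_upwards [Ioo_mem_nhds hy.1 hy.2] with x hx
        simp only [Pi.add_apply, Pi.sub_apply, Pi.mul_apply]
        rw [hQM x ⟨hx.1.le, hx.2.le⟩, hQN x]
        ring
      · have e : 1 - y ^ 2 = (1 - y) * (1 + y) := by ring
        rw [logFactor, log_one_sub_sq hy, e]
        generalize R y = r
        generalize quarticWeight y = w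
        generalize Q y = Q0
        generalize nullWeight y = n
        field_simp
        ring)
    ((((iR.add iC).sub (iW.const_mul α)).sub (iw.const_mul β)).sub (ih.const_mul γ))
  rw [intervalIntegral.integral_sub (((iR.add iC).sub (iW.const_mul α)).sub (iw.const_mul β))
      (ih.const_mul γ),
    intervalIntegral.integral_sub ((iR.add iC).sub (iW.const_mul α)) (iw.const_mul β),
    intervalIntegral.integral_sub (iR.add iC) (iW.const_mul α),
    intervalIntegral.integral_add iR iC, intervalIntegral.integral_const_mul,
    intervalIntegral.integral_const_mul, intervalIntegral.integral_const_mul,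
    integral_quarticWeight, integral_nullWeight, integral_quarticWeight_mul_logFactor] at hF
  have q0 : Q 0 = 0 := by rw [hQN]; ring
  have q1 : Q 1 = q := by
    have := hQM 1 ⟨zero_le_one, le_rfl⟩
    linarith
  rw [q0, q1, show (1 : ℝ) + 1 = 2 by norm_num] at hF
  simp only [Real.log_one, Real.log_zero, sub_self, sub_zero, add_zero, mul_zero] at hF
  linarith

/-! ### Explicit rational primitives. -/

theorem hasDerivAt_sexticDenom (y : ℝ) :
    HasDerivAt sexticDenom (-2 * y + 8 * y ^ 3 - 6 * y ^ 5) y := by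
  refine (((hasDerivAt_pow 2 y).const_sub 2).mul ((hasDerivAt_pow 4 y).const_add 1)).congr_deriv ?_
  norm_num
  ring

theorem continuousOn_div_sexticDenom_pow {P : ℝ → ℝ} (hP : Continuous P) (e : ℕ) :
    ContinuousOn (fun y => P y / sexticDenom y ^ e) (Icc 0 1) :=
  hP.continuousOn.div (continuous_sexticDenom.pow e).continuousOn
    fun _ hy => pow_ne_zero e (sexticDenom_pos hy).ne'

/-- The rational part of an antiderivative of `sumKernel (-7) 50 0`. -/
noncomputable def linearPrimitive (y : ℝ) : ℝ :=
  y * ((-16 + 60 * y ^ 2 - 36 * y ^ 4) / sexticDenom y ^ 1)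

/-- The rational part of an antiderivative of `sumKernel 0 (-367) 700`. -/
noncomputable def quadraticPrimitive (y : ℝ) : ℝ :=
  y * ((-240 + 1048 * y ^ 2 - 740 * y ^ 4 + 268 * y ^ 6 - 220 * y ^ 8 + 60 * y ^ 10) /
    sexticDenom y ^ 2)

/-- The point of the coefficients `-7` and `50` is that the non-rational part of the antiderivative
comes from `w` alone: neither `(1 - y²) / (1 + y⁴)` nor `1 / (2 - y²)` is left over. -/
theorem hasDerivAt_linearPrimitive {y : ℝ} (hy : y ∈ Icc (0 : ℝ) 1) :
    HasDerivAt linearPrimitive (sumKernel (-7) 50 0 y - 8 * quarticWeight y) y := by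
  have hD := (sexticDenom_pos hy).ne'
  have hP : HasDerivAt (fun y : ℝ => -16 + 60 * y ^ 2 - 36 * y ^ 4) (120 * y - 144 * y ^ 3) y := by
    refine ((((hasDerivAt_pow 2 y).const_mul 60).const_add (-16)).sub
      ((hasDerivAt_pow 4 y).const_mul 36)).congr_deriv ?_
    norm_num
    ring
  refine ((hasDerivAt_id' y).mul (hP.div ((hasDerivAt_sexticDenom y).pow 1)
    (pow_ne_zero 1 hD))).congr_deriv ?_
  have h1 := (one_add_pow_four_pos y).ne'
  have h2 := (two_sub_sq_pos hy).ne'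
  simp only [sumKernel, quarticWeight, sexticDenom, Pi.div_apply, Pi.pow_apply]
  field_simp
  ring

theorem hasDerivAt_quadraticPrimitive {y : ℝ} (hy : y ∈ Icc (0 : ℝ) 1) :
    HasDerivAt quadraticPrimitive (sumKernel 0 (-367) 700 y - 60 * quarticWeight y) y := by
  have hD := (sexticDenom_pos hy).ne'
  have hP : HasDerivAt (fun y : ℝ => -240 + 1048 * y ^ 2 - 740 * y ^ 4 + 268 * y ^ 6 - 220 * y ^ 8 +
      60 * y ^ 10) (2096 * y - 2960 * y ^ 3 + 1608 * y ^ 5 - 1760 * y ^ 7 + 600 * y ^ 9) y := by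
    refine (((((((hasDerivAt_pow 2 y).const_mul 1048).const_add (-240)).sub
      ((hasDerivAt_pow 4 y).const_mul 740)).add ((hasDerivAt_pow 6 y).const_mul 268)).sub
      ((hasDerivAt_pow 8 y).const_mul 220)).add ((hasDerivAt_pow 10 y).const_mul 60)).congr_deriv ?_
    norm_num
    ring
  refine ((hasDerivAt_id' y).mul (hP.div ((hasDerivAt_sexticDenom y).pow 2)
    (pow_ne_zero 2 hD))).congr_deriv ?_
  have h1 := (one_add_pow_four_pos y).ne'
  have h2 := (two_sub_sq_pos hy).ne'
  simp only [sumKernel, quarticWeight, sexticDenom, Pi.div_apply, Pi.pow_apply]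
  field_simp
  ring

/-- Here 4 is the value of the primitive at 1; the cofactor of `1 - y` is what the integration by
parts needs for continuity at that endpoint. The value 44 plays this role in the quadratic case. -/
theorem linearPrimitive_sub {y : ℝ} (hy : y ∈ Icc (0 : ℝ) 1) :
    linearPrimitive y - 4 = (1 - y) *
      ((-8 - 24 * y - 20 * y ^ 2 + 40 * y ^ 3 + 32 * y ^ 4 - 4 * y ^ 5) / sexticDenom y ^ 1) := by
  have h1 := (one_add_pow_four_pos y).ne'
  have h2 := (two_sub_sq_pos hy).ne'
  simp only [linearPrimitive, sexticDenom]
  field_simp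
  ring

theorem quadraticPrimitive_sub {y : ℝ} (hy : y ∈ Icc (0 : ℝ) 1) :
    quadraticPrimitive y - 44 = (1 - y) *
      ((-176 - 416 * y - 240 * y ^ 2 + 808 * y ^ 3 + 412 * y ^ 4 - 328 * y ^ 5 + 24 * y ^ 6 +
        292 * y ^ 7 + 28 * y ^ 8 - 192 * y ^ 9 - 16 * y ^ 10 + 44 * y ^ 11) /
          sexticDenom y ^ 2) := by
  have h1 := (one_add_pow_four_pos y).ne'
  have h2 := (two_sub_sq_pos hy).ne'
  simp only [quadraticPrimitive, sexticDenom]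
  field_simp
  ring

theorem hasDerivAt_quintic_div_sexticDenom (a b c : ℝ) {y : ℝ} (hy : y ∈ Icc (0 : ℝ) 1) :
    HasDerivAt (fun y => (a * y + b * y ^ 3 + c * y ^ 5) / sexticDenom y ^ 1)
      (((a + 3 * b * y ^ 2 + 5 * c * y ^ 4) * sexticDenom y -
        (a * y + b * y ^ 3 + c * y ^ 5) * (-2 * y + 8 * y ^ 3 - 6 * y ^ 5)) /
          sexticDenom y ^ 2) y := by
  have hD := (sexticDenom_pos hy).ne'
  have hP : HasDerivAt (fun y : ℝ => a * y + b * y ^ 3 + c * y ^ 5)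
      (a + 3 * b * y ^ 2 + 5 * c * y ^ 4) y := by
    refine ((((hasDerivAt_id' y).const_mul a).add ((hasDerivAt_pow 3 y).const_mul b)).add
      ((hasDerivAt_pow 5 y).const_mul c)).congr_deriv ?_
    norm_num
    ring
  refine (hP.div ((hasDerivAt_sexticDenom y).pow 1) (pow_ne_zero 1 hD)).congr_deriv ?_
  simp only [Pi.pow_apply, pow_one]
  norm_num

/-- In the linear case what remains after integration by parts is exactly `β w + γ nullWeight`, so
`T = 0` and there is no rational boundary term. -/
theorem integral_linear (c d β γ : ℝ)
    (h : ∀ y ∈ Ioo (0 : ℝ) 1, sumKernel d 0 0 y -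
      linearPrimitive y * (2 / y + 2 * c * y / (1 - y ^ 2)) + 2 * c * 4 / (1 - y ^ 2) -
        β * quarticWeight y - γ * nullWeight y = 0) :
    (∫ y in (0 : ℝ)..1, sumKernel (-7) 50 0 y * logFactor c y) +
        ∫ y in (0 : ℝ)..1, sumKernel d 0 0 y =
      8 * (3 / 2 * c * Real.log 2 * (Real.pi / (2 * √2)) - (2 - c) * LTwoNegEight) +
        β * (Real.pi / (2 * √2)) := by
  rw [integral_mul_logFactor_add (T := fun _ => 0) (q := 4) (α := 8) (β := β) (γ := γ)
    (continuousOn_sumKernel _ _ _)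
    (continuousOn_sumKernel _ _ _) (continuousOn_div_sexticDenom_pow (by fun_prop) 1)
    (continuousOn_div_sexticDenom_pow (by fun_prop) 1) continuousOn_const (fun _ => rfl)
    (fun y hy => linearPrimitive_sub hy)
    (fun y hy => hasDerivAt_linearPrimitive (Ioo_subset_Icc_self hy))
    (fun y hy => (hasDerivAt_const y (0 : ℝ)).congr_deriv (h y hy).symm)]
  ring

/-- Here the remainder also has a rational primitive `T` with numerator `t₁ y + t₃ y³ + t₅ y⁵` over
`sexticDenom`. The term `(t₁ + t₃ + t₅) / 2` is `T 1`, as `sexticDenom 1 = 2`. -/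
theorem integral_quadratic (c d β γ t₁ t₃ t₅ : ℝ)
    (h : ∀ y ∈ Ioo (0 : ℝ) 1, ((t₁ + 3 * t₃ * y ^ 2 + 5 * t₅ * y ^ 4) * sexticDenom y -
        (t₁ * y + t₃ * y ^ 3 + t₅ * y ^ 5) * (-2 * y + 8 * y ^ 3 - 6 * y ^ 5)) /
          sexticDenom y ^ 2 = sumKernel 0 d 0 y -
      quadraticPrimitive y * (2 / y + 2 * c * y / (1 - y ^ 2)) + 2 * c * 44 / (1 - y ^ 2) -
        β * quarticWeight y - γ * nullWeight y) :
    (∫ y in (0 : ℝ)..1, sumKernel 0 (-367) 700 y * logFactor c y) +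
        ∫ y in (0 : ℝ)..1, sumKernel 0 d 0 y =
      (t₁ + t₃ + t₅) / 2 +
      60 * (3 / 2 * c * Real.log 2 * (Real.pi / (2 * √2)) - (2 - c) * LTwoNegEight) +
        β * (Real.pi / (2 * √2)) := by
  rw [integral_mul_logFactor_add
    (T := fun y => (t₁ * y + t₃ * y ^ 3 + t₅ * y ^ 5) / sexticDenom y ^ 1)
    (q := 44) (α := 60) (β := β) (γ := γ)
    (continuousOn_sumKernel _ _ _)
    (continuousOn_sumKernel _ _ _) (continuousOn_div_sexticDenom_pow (by fun_prop) 2)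
    (continuousOn_div_sexticDenom_pow (by fun_prop) 2)
    (continuousOn_div_sexticDenom_pow (by fun_prop) 1) (fun _ => rfl)
    (fun y hy => quadraticPrimitive_sub hy)
    (fun y hy => hasDerivAt_quadraticPrimitive (Ioo_subset_Icc_self hy))
    (fun y hy => (hasDerivAt_quintic_div_sexticDenom t₁ t₃ t₅
      (Ioo_subset_Icc_self hy)).congr_deriv (h y hy))]
  norm_num [sexticDenom]

/-! ### The five integrals evaluated. -/

theorem integral_sumKernel_quadratic :
    ∫ y in (0 : ℝ)..1, sumKernel 0 (-367) 700 y = 44 + 60 * (Real.pi / (2 * √2)) := by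
  have hI : uIcc (0 : ℝ) 1 = Icc 0 1 := uIcc_of_le zero_le_one
  have i1 : IntervalIntegrable (sumKernel 0 (-367) 700) volume 0 1 :=
    ContinuousOn.intervalIntegrable (by rw [hI]; exact continuousOn_sumKernel _ _ _)
  have i2 : IntervalIntegrable (fun y => 60 * quarticWeight y) volume 0 1 :=
    (continuous_quarticWeight.intervalIntegrable 0 1).const_mul 60
  have h := integral_eq_sub_of_hasDerivAt
    (fun y hy => hasDerivAt_quadraticPrimitive (y := y) (by rwa [hI] at hy)) (i1.sub i2)
  rw [intervalIntegral.integral_sub i1 i2, intervalIntegral.integral_const_mul,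
    integral_quarticWeight] at h
  have : quadraticPrimitive 1 - quadraticPrimitive 0 = 44 := by
    norm_num [quadraticPrimitive, sexticDenom]
  linarith

theorem integral_linear_one :
    (∫ y in (0 : ℝ)..1, sumKernel (-7) 50 0 y * logFactor 1 y) +
        ∫ y in (0 : ℝ)..1, sumKernel 5 0 0 y =
      3 * √2 * Real.pi * (1 + Real.log 2) - 8 * LTwoNegEight := by
  have s2 : √2 ^ 2 = (2 : ℝ) := Real.sq_sqrt (by norm_num)
  rw [integral_linear 1 5 12 24]
  · field_simp
    linear_combination (-12 * Real.pi * (1 + Real.log 2)) * s2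
  · intro y hy
    have h0 : y ≠ 0 := hy.1.ne'
    have h1 := (one_add_pow_four_pos y).ne'
    have h2 := (two_sub_sq_pos (Ioo_subset_Icc_self hy)).ne'
    have h3 : 1 - y ^ 2 ≠ 0 := by nlinarith [hy.1, hy.2]
    simp only [sumKernel, linearPrimitive, quarticWeight, nullWeight, sexticDenom]
    field_simp
    ring

theorem integral_linear_two :
    (∫ y in (0 : ℝ)..1, sumKernel (-7) 50 0 y * logFactor 2 y) +
        ∫ y in (0 : ℝ)..1, sumKernel (-10) 0 0 y =
      2 * √2 * Real.pi * (2 + 3 * Real.log 2) := by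
  have s2 : √2 ^ 2 = (2 : ℝ) := Real.sq_sqrt (by norm_num)
  rw [integral_linear 2 (-10) 16 32]
  · field_simp
    rw [s2]
    ring
  · intro y hy
    have h0 : y ≠ 0 := hy.1.ne'
    have h1 := (one_add_pow_four_pos y).ne'
    have h2 := (two_sub_sq_pos (Ioo_subset_Icc_self hy)).ne'
    have h3 : 1 - y ^ 2 ≠ 0 := by nlinarith [hy.1, hy.2]
    simp only [sumKernel, linearPrimitive, quarticWeight, nullWeight, sexticDenom]
    field_simp
    ring

theorem integral_quadratic_one :
    (∫ y in (0 : ℝ)..1, sumKernel 0 (-367) 700 y * logFactor 1 y) +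
        ∫ y in (0 : ℝ)..1, sumKernel 0 (2225 / 7) 0 y =
      (276 + 493 * Real.pi / √2 + 315 * Real.pi * Real.log 2 / √2 - 420 * LTwoNegEight) / 7 := by
  rw [integral_quadratic 1 (2225 / 7) (986 / 7) 124 (72 / 7) (2082 / 7) (-1602 / 7)]
  · field_simp
    ring
  · intro y hy
    have h0 : y ≠ 0 := hy.1.ne'
    have h1 := (one_add_pow_four_pos y).ne'
    have h2 := (two_sub_sq_pos (Ioo_subset_Icc_self hy)).ne'
    have h3 : 1 - y ^ 2 ≠ 0 := by nlinarith [hy.1, hy.2]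
    simp only [sumKernel, quadraticPrimitive, quarticWeight, nullWeight, sexticDenom]
    field_simp
    ring

theorem integral_quadratic_two :
    (∫ y in (0 : ℝ)..1, sumKernel 0 (-367) 700 y * logFactor 2 y) +
        ∫ y in (0 : ℝ)..1, sumKernel 0 (4850 / 21) 0 y =
      (976 + 1020 * √2 * Real.pi + 945 * √2 * Real.pi * Real.log 2) / 21 := by
  have s2 : √2 ^ 2 = (2 : ℝ) := Real.sq_sqrt (by norm_num)
  rw [integral_quadratic 2 (4850 / 21) (1360 / 7) (496 / 3) (800 / 21) (2136 / 7) (-1752 / 7)]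
  · field_simp
    linear_combination (-14 * (1020 * Real.pi + 945 * Real.pi * Real.log 2)) * s2
  · intro y hy
    have h0 : y ≠ 0 := hy.1.ne'
    have h1 := (one_add_pow_four_pos y).ne'
    have h2 := (two_sub_sq_pos (Ioo_subset_Icc_self hy)).ne'
    have h3 : 1 - y ^ 2 ≠ 0 := by nlinarith [hy.1, hy.2]
    simp only [sumKernel, quadraticPrimitive, quarticWeight, nullWeight, sexticDenom]
    field_simp
    ring

/-! ### Passage from the integrals back to the series. -/

theorem hasSum_integral_logFactor (a b c d e s : ℝ) :
    HasSum (fun k => quadCoeff a b c k * (∫ y in (0 : ℝ)..1, weightKernel k y * logFactor s y) +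
        quadCoeff d e 0 k * (binomWeight (k + 1) / ((k : ℝ) + 1)))
      ((∫ y in (0 : ℝ)..1, sumKernel a b c y * logFactor s y) +
        ∫ y in (0 : ℝ)..1, sumKernel d e 0 y) := by
  have h1 := hasSum_integral_weightKernel a b c (intervalIntegrable_logFactor s)
  have h2 := hasSum_integral_weightKernel d e 0 (g := fun _ => 1) intervalIntegrable_const
  simp only [mul_one, integral_weightKernel] at h2
  exact h1.add h2

theorem hasSum_pnat_of_succ {f : ℕ+ → ℝ} {g : ℕ → ℝ} {a b : ℝ} (hg : HasSum g a)
    (hfg : ∀ k, f (Nat.succPNat k) = g k) (hab : a = b) : HasSum f b := by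
  rw [← Equiv.pnatEquivNat.symm.hasSum_iff, ← hab,
    show f ∘ Equiv.pnatEquivNat.symm = g from funext hfg]
  exact hg

/-- `HasSum` in `ℝ` is unconditional, hence it includes absolute convergence. -/
theorem mainTheorem1 :
    HasSum (fun k : ℕ => (350 * (k : ℝ) - 17) * binomWeight k)
      (15 * √2 * Real.pi + 27) ∧
    HasSum (fun k : ℕ+ =>
        (21 * (350 * ((k : ℕ) : ℝ) - 17) * (2 * Hnum (6 * k - 1) - Hnum (3 * k - 1) - Hnum (k - 1)) + 4850)
          * binomWeight k)
      (976 + 1020 * √2 * Real.pi + 945 * √2 * Real.pi * Real.log 2) ∧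
    HasSum (fun k : ℕ+ =>
        (7 * (350 * ((k : ℕ) : ℝ) - 17) * (Hnum (2 * k - 1) - Hnum (k - 1)) + 2225) * binomWeight k)
      (276 + 493 * Real.pi / √2 + 315 * Real.pi * Real.log 2 / √2 - 420 * LTwoNegEight) ∧
    HasSum (fun k : ℕ+ =>
        ((50 * ((k : ℕ) : ℝ) - 7) * (Hnum (2 * k - 1) - Hnum (k - 1)) + 5) / ((k : ℕ) : ℝ)
          * binomWeight k)
      (3 * √2 * Real.pi * (1 + Real.log 2) - 8 * LTwoNegEight) ∧
    HasSum (fun k : ℕ+ =>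
        ((50 * ((k : ℕ) : ℝ) - 7) * (2 * Hnum (6 * k - 1) - Hnum (3 * k - 1) - Hnum (k - 1)) - 10)
          / ((k : ℕ) : ℝ) * binomWeight k)
      (2 * √2 * Real.pi * (2 + 3 * Real.log 2)) := by
  have hpos (k : ℕ) : (k : ℝ) + 1 ≠ 0 := by positivity
  refine ⟨?_, ?_, ?_, ?_, ?_⟩
  -- With `K = k + 1`, `K(350K - 17) = -367K + 700 · K(K + 1) / 2`; the extra factor `K` compensates
  -- the division by `K` in the integral representation.
  · have h := hasSum_integral_weightKernel 0 (-367) 700 (g := fun _ => 1) intervalIntegrable_const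
    simp only [mul_one, integral_weightKernel, integral_sumKernel_quadratic] at h
    have s2 : √2 ^ 2 = (2 : ℝ) := Real.sq_sqrt (by norm_num)
    have e : 15 * √2 * Real.pi + 27 = (44 + 60 * (Real.pi / (2 * √2))) - 17 := by
      field_simp
      linear_combination (30 * Real.pi) * s2
    rw [e]
    -- The integrals cover the indices from 1 on; the term at index 0 is `-17`.
    refine (hasSum_nat_add_iff' 1).mp ?_
    have h0 : (44 + 60 * (Real.pi / (2 * √2))) - 17 -
        ∑ i ∈ Finset.range 1, (350 * ((i : ℕ) : ℝ) - 17) * binomWeight i =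
        44 + 60 * (Real.pi / (2 * √2)) := by
      simp [binomWeight]
    rw [h0]
    refine (congrArg (fun f => HasSum f _) (funext fun k => ?_)).mpr h
    have := hpos k
    rw [quadCoeff]
    push_cast
    field_simp
    ring
  -- The harmonic part is normalized to coefficient `K(350K - 17)`, so the constant 4850 enters as
  -- `4850 / 21` times `K`; the third series is treated likewise with 7.
  · refine hasSum_pnat_of_succ
      ((hasSum_integral_logFactor 0 (-367) 700 0 (4850 / 21) 2).mul_left 21) (fun k => ?_)
      (by rw [integral_quadratic_two]; ring)
    have := hpos k
    rw [integral_weightKernel_mul_logFactor_two, quadCoeff, quadCoeff, Nat.succPNat_coe,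
      Nat.succ_eq_add_one, Nat.add_sub_cancel]
    push_cast
    field_simp
    ring
  · refine hasSum_pnat_of_succ
      ((hasSum_integral_logFactor 0 (-367) 700 0 (2225 / 7) 1).mul_left 7) (fun k => ?_)
      (by rw [integral_quadratic_one]; ring)
    have := hpos k
    rw [integral_weightKernel_mul_logFactor_one, quadCoeff, quadCoeff, Nat.succPNat_coe,
      Nat.succ_eq_add_one, Nat.add_sub_cancel]
    push_cast
    field_simp
    ring
  · refine hasSum_pnat_of_succ (hasSum_integral_logFactor (-7) 50 0 5 0 1) (fun k => ?_)
      integral_linear_one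
    have := hpos k
    rw [integral_weightKernel_mul_logFactor_one, quadCoeff, quadCoeff, Nat.succPNat_coe,
      Nat.succ_eq_add_one, Nat.add_sub_cancel]
    push_cast
    field_simp
    ring
  · refine hasSum_pnat_of_succ (hasSum_integral_logFactor (-7) 50 0 (-10) 0 2) (fun k => ?_)
      integral_linear_two
    have := hpos k
    rw [integral_weightKernel_mul_logFactor_two, quadCoeff, quadCoeff, Nat.succPNat_coe,
      Nat.succ_eq_add_one, Nat.add_sub_cancel]
    push_cast
    field_simp
    ring
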